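/- Let $n\in\mathbb N\cup\{\infty,\omega\}$ and let $\mathcal B$ be a full subcategory of the category of real $C^n$ manifolds and $C^n$ maps (for example, $n=\infty$ and all finite-dimensional Hausdorff second countable smooth manifolds). Let $\pi:\mathcal V\to\mathcal B$ be the fibration of vector bundles: an object is a manifold $A\in\mathcal B$ with a real $C^n$ vector bundle $X\to A$ of finite rank, and an arrow $(A,X)\to(B,Y)$ is a $C^n$ map $\alpha:A\to B$ together with a fibrewise linear $C^n$ map $t:X\to Y$ of total spaces over $\alpha$, i.e. linear maps $t_a:X_a\to Y_{\alpha(a)}$, $a\in A$. Write $\mathcal V_A$ for the category of vector bundles over $A$ (with maps over $1_A$). For a fibration $\pi:\mathcal X\to\mathcal B$, the fibrewise dual fibration $\pi^*:\mathcal X^*\to\mathcal B$ has the same objects as $\mathcal X$; an arrow $X\to Y$ of $\mathcal X^*$ over $\alpha$ is an equivalence class $\{(v,h)\}$ of spans $X\xleftarrow{v}W\xrightarrow{h}Y$ in $\mathcal X$ with $v$ vertical and $h$ Cartesian over $\alpha$, where two spans are equivalent if they differ by a vertical isomorphism of their apices; composition is the composition of spans (by means of Cartesian lifts), and $\pi^*\{(v,h)\}=\alpha$.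 Its fibre over $A$ is $(\mathcal X_A)^{op}$, a vertical $v$ being identified with $\{(v,1)\}$. An arrow $h:X\to Y$ over $\alpha:A\to B$ is Cartesian if for all $\xi:C\to A$ and $Z$ over $C$, composition with $h$ is a bijection from arrows $Z\to X$ over $\xi$ to arrows $Z\to Y$ over $\alpha\circ\xi$. Let $X^\dagger$ be the fibrewise linear dual of $X$ (the bundle with fibres $(X_a)^\dagger=\mathrm{Hom}(X_a,\mathbb R)$), so that $\dagger$ is a functor $\mathcal V_A\to(\mathcal V_A)^{op}$ for each $A\in\mathcal B$. Proposition. There is a functor $D:\mathcal V\to\mathcal V^*$ such that: 1. $D$ is a functor over $\mathcal B$: $\pi^*\circ D=\pi$. 2. $D$ extends the dualization functors: for each $A\in\mathcal B$ its restriction to $\mathcal V_A$ is $\dagger:\mathcal V_A\to(\mathcal V_A)^{op}\cong(\mathcal V^*)_A$. 3. $D$ is given by fibrewise transposition: $D(X)=X^\dagger$, and for $t:X\to Y$ over $\alpha$, $D(t)$ is the class of a span $X^\dagger\xleftarrow{v}W\xrightarrow{h}Y^\dagger$ ($v$ vertical, $h$ Cartesian over $\alpha$; e.g. $W=\alpha^*(Y^\dagger)$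 with its canonical map $h$ to $Y^\dagger$) with $v(w)=h(w)\circ t_a$ for all $a\in A$ and $w\in W_a$. Moreover $D$ is the only functor $\mathcal V\to\mathcal V^*$ with this property. 4. $D$ is Cartesian: it sends Cartesian arrows to Cartesian arrows. -/

import Mathlib

open CategoryTheory CategoryTheory.Functor Bundle
open scoped Manifold ContDiff

universe u v₁ v₂ u₁ u₂

noncomputable section

/-! ### The fibrewise dual of a fibration

`p.IsStronglyCartesian f φ` is Mathlib's name for "`φ` lies over `f` and is Cartesian" in the
sense of the full universal property; `p.IsHomLift f φ` says that `φ` lies over `f`. -/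

section FibrewiseDual

variable {𝒳 : Type u₁} {𝓑 : Type u₂} [Category.{v₁} 𝒳] [Category.{v₂} 𝓑]

/-- A vh span from `X` to `Y`: a vertical arrow `vert : apex ⟶ X` and a Cartesian arrow
`horiz : apex ⟶ Y`, the latter over `base`. -/
structure VhSpan (p : 𝒳 ⥤ 𝓑) (X Y : 𝒳) where
  base : p.obj X ⟶ p.obj Y
  apex : 𝒳
  vert : apex ⟶ X
  horiz : apex ⟶ Y
  vertical : p.IsHomLift (𝟙 (p.obj X)) vert
  cartesian : p.IsStronglyCartesian base horiz

namespace VhSpan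

attribute [instance] VhSpan.vertical VhSpan.cartesian

variable {p : 𝒳 ⥤ 𝓑} {X Y Z W : 𝒳}

/-- Two vh spans are equivalent if they differ by a vertical isomorphism of their apices. -/
def Rel (s t : VhSpan p X Y) : Prop :=
  ∃ i : s.apex ≅ t.apex, p.IsHomLift (𝟙 (p.obj X)) i.hom ∧
    i.hom ≫ t.vert = s.vert ∧ i.hom ≫ t.horiz = s.horiz

theorem Rel.refl (s : VhSpan p X Y) : Rel s s :=
  ⟨Iso.refl _, IsHomLift.id (IsHomLift.domain_eq p (𝟙 (p.obj X)) s.vert), by simp, by simp⟩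

instance setoid (p : 𝒳 ⥤ 𝓑) (X Y : 𝒳) : Setoid (VhSpan p X Y) where
  r := Rel
  iseqv :=
    { refl := Rel.refl
      symm := by
        rintro s t ⟨i, hi, h1, h2⟩
        exact ⟨i.symm, by dsimp; infer_instance, by simp [← h1], by simp [← h2]⟩
      trans := by
        rintro s t r ⟨i, hi, h1, h2⟩ ⟨j, hj, h3, h4⟩
        exact ⟨i ≪≫ j, by dsimp; infer_instance, by simp [h3, h1], by simp [h4, h2]⟩ }

theorem Rel.base_eq {s t : VhSpan p X Y} (h : Rel s t) : s.base = t.base := by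
  obtain ⟨i, hi, -, h2⟩ := h
  have e := s.cartesian.toIsHomLift
  have e' : p.IsHomLift (𝟙 _ ≫ t.base) (i.hom ≫ t.horiz) := inferInstance
  rw [h2, Category.id_comp] at e'
  rw [IsHomLift.fac p s.base s.horiz, IsHomLift.fac p t.base s.horiz]

/-- The vh span `(v, 1)` of an arrow `v` that is vertical over `A`. -/
def ofVertical {A : 𝓑} (v : Y ⟶ X) (hv : p.IsHomLift (𝟙 A) v) : VhSpan p X Y where
  base := eqToHom ((IsHomLift.codomain_eq p (𝟙 A) v).trans (IsHomLift.domain_eq p (𝟙 A) v).symm)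
  apex := Y
  vert := v
  horiz := 𝟙 Y
  vertical := by
    obtain rfl := IsHomLift.codomain_eq p (𝟙 A) v
    exact hv
  cartesian := by
    have h := (IsHomLift.codomain_eq p (𝟙 A) v).trans (IsHomLift.domain_eq p (𝟙 A) v).symm
    have : p.IsHomLift (eqToHom h) (𝟙 Y) := by
      have := IsHomLift.lift_eqToHom_comp p (𝟙 (p.obj Y)) (𝟙 Y) h
      simpa using this
    infer_instance

theorem apex_obj (t : VhSpan p Y Z) : p.obj t.apex = p.obj Y :=
  IsHomLift.domain_eq p (𝟙 (p.obj Y)) t.vert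

/-- `r` is a composite of `s` and `t`: its apex completes `s.horiz` and `t.vert` to a commutative
square with vertical arrow `w` and Cartesian arrow `k`. -/
structure IsComp (s : VhSpan p X Y) (t : VhSpan p Y Z) (r : VhSpan p X Z) where
  w : r.apex ⟶ s.apex
  k : r.apex ⟶ t.apex
  vertical : p.IsHomLift (𝟙 (p.obj X)) w
  cartesian : p.IsStronglyCartesian s.base k
  sq : k ≫ t.vert = w ≫ s.horiz
  vert_eq : w ≫ s.vert = r.vert
  horiz_eq : k ≫ t.horiz = r.horiz

/-- Any two composites are equivalent, also after changing `s` and `t` by an equivalence. -/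
theorem IsComp.rel {s s' : VhSpan p X Y} {t t' : VhSpan p Y Z} {r r' : VhSpan p X Z}
    (c : IsComp s t r) (c' : IsComp s' t' r') (hs : Rel s s') (ht : Rel t t') : Rel r r' := by
  have hb := hs.base_eq
  have := c.vertical
  have := c.cartesian
  have := c'.vertical
  have := c'.cartesian
  obtain ⟨i, hi, hi1, hi2⟩ := hs
  obtain ⟨j, hj, hj1, hj2⟩ := ht
  have hck : p.IsStronglyCartesian s.base c'.k := by rw [hb]; infer_instance
  have hjc : p.IsStronglyCartesian (s.base ≫ 𝟙 _) (c.k ≫ j.hom) := inferInstance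
  rw [Category.comp_id] at hjc
  let e := IsCartesian.domainUniqueUpToIso p s.base c'.k (c.k ≫ j.hom)
  have he1 : e.hom ≫ c'.k = c.k ≫ j.hom := IsCartesian.fac p s.base c'.k _
  have he : p.IsHomLift (𝟙 (p.obj X)) e.hom :=
    IsCartesian.domainUniqueUpToIso_inv_isHomLift p s.base c'.k (c.k ≫ j.hom)
  have hw : e.hom ≫ c'.w = c.w ≫ i.hom := by
    have h1 : p.IsHomLift (𝟙 (p.obj X)) (e.hom ≫ c'.w) := inferInstance
    have h2 : p.IsHomLift (𝟙 (p.obj X)) (c.w ≫ i.hom) := inferInstance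
    refine IsStronglyCartesian.ext p s'.base s'.horiz (𝟙 (p.obj X)) ?_
    rw [Category.assoc, ← c'.sq, ← Category.assoc, he1, Category.assoc, hj1, Category.assoc, hi2,
      c.sq]
  refine ⟨e, he, ?_, ?_⟩
  · rw [← c'.vert_eq, ← Category.assoc, hw, Category.assoc, hi1, c.vert_eq]
  · rw [← c'.horiz_eq, ← Category.assoc, he1, Category.assoc, hj2, c.horiz_eq]

section

variable [p.IsFibered]

/-- A chosen Cartesian arrow over `s.base` with codomain the apex of `t`. -/
abbrev compK (s : VhSpan p X Y) (t : VhSpan p Y Z) :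
    IsPreFibered.pullbackObj t.apex_obj s.base ⟶ t.apex :=
  IsPreFibered.pullbackMap t.apex_obj s.base

/-- The vertical arrow `w` with `w ≫ s.horiz = compK s t ≫ t.vert`. -/
def compW (s : VhSpan p X Y) (t : VhSpan p Y Z) :
    IsPreFibered.pullbackObj t.apex_obj s.base ⟶ s.apex :=
  IsStronglyCartesian.map p s.base s.horiz (g := 𝟙 (p.obj X)) (f' := s.base ≫ 𝟙 (p.obj Y))
    (by simp) (compK s t ≫ t.vert)

instance (s : VhSpan p X Y) (t : VhSpan p Y Z) : p.IsHomLift (𝟙 (p.obj X)) (compW s t) := by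
  unfold compW; infer_instance

theorem compW_horiz (s : VhSpan p X Y) (t : VhSpan p Y Z) :
    compW s t ≫ s.horiz = compK s t ≫ t.vert :=
  IsStronglyCartesian.fac p s.base s.horiz _ _

/-- The composite of two vh spans, formed with a chosen Cartesian lift. -/
def comp (s : VhSpan p X Y) (t : VhSpan p Y Z) : VhSpan p X Z where
  base := s.base ≫ t.base
  apex := IsPreFibered.pullbackObj t.apex_obj s.base
  vert := compW s t ≫ s.vert
  horiz := compK s t ≫ t.horiz
  vertical := inferInstance
  cartesian := inferInstance

/-- The chosen composite is a composite. -/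
def compIsComp (s : VhSpan p X Y) (t : VhSpan p Y Z) : IsComp s t (s.comp t) where
  w := compW s t
  k := compK s t
  vertical := inferInstanceAs (p.IsHomLift (𝟙 (p.obj X)) (compW s t))
  cartesian := inferInstanceAs (p.IsStronglyCartesian s.base (compK s t))
  sq := (compW_horiz s t).symm
  vert_eq := rfl
  horiz_eq := rfl

end

end VhSpan

/-- The fibrewise dual of a fibration `p : 𝒳 ⥤ 𝓑`: it has the objects of `𝒳`, and its arrows
("comorphisms") are the equivalence classes of vh spans. -/
structure FibDual (p : 𝒳 ⥤ 𝓑) where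
  of ::
  obj : 𝒳

namespace VhSpan

variable {p : 𝒳 ⥤ 𝓑} {X Y Z W : 𝒳}

/-- The identity vh span `(1, 1)`. -/
def id (p : 𝒳 ⥤ 𝓑) (X : 𝒳) : VhSpan p X X :=
  ofVertical (A := p.obj X) (𝟙 X) inferInstance

def idIsComp (s : VhSpan p X Y) : IsComp (id p X) s s where
  w := s.vert
  k := 𝟙 s.apex
  vertical := s.vertical
  cartesian := by
    have h : p.IsHomLift (𝟙 (p.obj X)) (𝟙 s.apex) :=
      IsHomLift.id (IsHomLift.domain_eq p (𝟙 (p.obj X)) s.vert)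
    have h' : p.IsStronglyCartesian (𝟙 (p.obj X)) (𝟙 s.apex) := inferInstance
    exact h'
  sq := by simp [id, ofVertical]
  vert_eq := by simp [id, ofVertical]
  horiz_eq := by simp

def isCompId (s : VhSpan p X Y) : IsComp s (id p Y) s where
  w := 𝟙 s.apex
  k := s.horiz
  vertical := IsHomLift.id (IsHomLift.domain_eq p (𝟙 (p.obj X)) s.vert)
  cartesian := s.cartesian
  sq := by simp [id, ofVertical]
  vert_eq := by simp
  horiz_eq := by simp [id, ofVertical]

def ofVerticalIsComp {A : 𝓑} (v : Y ⟶ X) (hv : p.IsHomLift (𝟙 A) v) (v' : Z ⟶ Y)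
    (hv' : p.IsHomLift (𝟙 A) v') (hvv : p.IsHomLift (𝟙 A) (v' ≫ v)) :
    IsComp (ofVertical v hv) (ofVertical v' hv') (ofVertical (v' ≫ v) hvv) where
  w := v'
  k := 𝟙 Z
  vertical := by
    obtain rfl := IsHomLift.codomain_eq p (𝟙 A) v
    exact hv'
  cartesian := by
    have h : p.obj X = p.obj Y :=
      (IsHomLift.codomain_eq p (𝟙 A) v).trans (IsHomLift.domain_eq p (𝟙 A) v).symm
    have hZ : p.obj Z = p.obj Y :=
      (IsHomLift.domain_eq p (𝟙 A) v').trans (IsHomLift.domain_eq p (𝟙 A) v).symm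
    have h1 : p.IsHomLift (𝟙 (p.obj Y)) (𝟙 Z) := IsHomLift.id hZ
    have h2 : p.IsHomLift (eqToHom h ≫ 𝟙 (p.obj Y)) (𝟙 Z) := inferInstance
    rw [Category.comp_id] at h2
    change p.IsStronglyCartesian (eqToHom h) (𝟙 Z)
    infer_instance
  sq := by simp [ofVertical]
  vert_eq := by simp [ofVertical]
  horiz_eq := by simp [ofVertical]

theorem comp_assoc_rel [p.IsFibered] (s : VhSpan p X Y) (t : VhSpan p Y Z)
    (r : VhSpan p Z W) : Rel ((s.comp t).comp r) (s.comp (t.comp r)) := by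
  have c1 := s.compIsComp t
  have c2 := (s.comp t).compIsComp r
  have c3 := t.compIsComp r
  have hk2 : p.IsStronglyCartesian (s.base ≫ t.base) c2.k := c2.cartesian
  have := c1.vertical
  have := c1.cartesian
  have := c2.vertical
  have := c3.vertical
  have := c3.cartesian
  let k := IsStronglyCartesian.map p t.base c3.k (f' := s.base ≫ t.base) rfl c2.k
  have hk : k ≫ c3.k = c2.k := IsStronglyCartesian.fac p t.base c3.k rfl c2.k
  have hkl : p.IsHomLift s.base k := inferInstance
  have hkc : p.IsStronglyCartesian s.base k := by
    have : p.IsStronglyCartesian (s.base ≫ t.base) (k ≫ c3.k) := by rw [hk]; exact hk2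
    exact IsStronglyCartesian.of_comp p (g := t.base) (ψ := c3.k)
  have key : k ≫ c3.w = c2.w ≫ c1.k := by
    have h1 : p.IsHomLift s.base (k ≫ c3.w) := inferInstance
    have h2 : p.IsHomLift s.base (c2.w ≫ c1.k) := inferInstance
    refine IsStronglyCartesian.ext p t.base t.horiz s.base ?_
    rw [Category.assoc, ← c3.sq, ← Category.assoc, hk, c2.sq, Category.assoc, c1.horiz_eq]
  have c : IsComp s (t.comp r) ((s.comp t).comp r) :=
    { w := c2.w ≫ c1.w
      k := k
      vertical := inferInstance
      cartesian := hkc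
      sq := by
        rw [← c3.vert_eq, ← Category.assoc, key, Category.assoc, c1.sq, Category.assoc]
      vert_eq := by rw [Category.assoc, c1.vert_eq, c2.vert_eq]
      horiz_eq := by rw [← c3.horiz_eq, ← Category.assoc, hk, c2.horiz_eq] }
  exact c.rel (s.compIsComp (t.comp r)) (Rel.refl _) (Rel.refl _)

end VhSpan

namespace FibDual

variable (p : 𝒳 ⥤ 𝓑)

/-- Comorphisms. -/
def Hom (X Y : FibDual p) : Type (max u₁ v₁ v₂) :=
  Quotient (VhSpan.setoid p X.obj Y.obj)

variable [p.IsFibered]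

instance category : Category.{max u₁ v₁ v₂} (FibDual p) where
  Hom := Hom p
  id X := Quotient.mk _ (VhSpan.id p X.obj)
  comp := Quotient.map₂ VhSpan.comp fun s s' hs t t' ht =>
    (s.compIsComp t).rel (s'.compIsComp t') hs ht
  id_comp := by
    rintro X Y ⟨s⟩
    exact Quotient.sound (((VhSpan.id p X.obj).compIsComp s).rel s.idIsComp
      (VhSpan.Rel.refl _) (VhSpan.Rel.refl _))
  comp_id := by
    rintro X Y ⟨s⟩
    exact Quotient.sound ((s.compIsComp (VhSpan.id p Y.obj)).rel s.isCompId
      (VhSpan.Rel.refl _) (VhSpan.Rel.refl _))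
  assoc := by
    rintro X Y Z W ⟨s⟩ ⟨t⟩ ⟨r⟩
    exact Quotient.sound (VhSpan.comp_assoc_rel s t r)

variable {p}

/-- The comorphism `{(v, h)}` represented by a vh span. -/
def mk {X Y : 𝒳} (s : VhSpan p X Y) : (of X : FibDual p) ⟶ of Y :=
  Quotient.mk (VhSpan.setoid p X Y) s

theorem mk_comp_mk {X Y Z : 𝒳} {s : VhSpan p X Y} {t : VhSpan p Y Z} {r : VhSpan p X Z}
    (c : VhSpan.IsComp s t r) : mk s ≫ mk t = mk r :=
  Quotient.sound ((s.compIsComp t).rel c (VhSpan.Rel.refl _) (VhSpan.Rel.refl _))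

variable (p)

/-- The projection of the fibrewise dual to the base category, `{(v, h)} ↦ p h`. -/
def proj : FibDual p ⥤ 𝓑 where
  obj X := p.obj X.obj
  map {X Y} := Quotient.lift (fun s : VhSpan p X.obj Y.obj => s.base)
    fun _ _ h => VhSpan.Rel.base_eq h
  map_id _ := rfl
  map_comp := by
    rintro X Y Z ⟨s⟩ ⟨t⟩
    rfl

/-- The opposite of the fibre of `p` over `A`, as the fibre of the fibrewise dual over `A`:
a vertical arrow `v` is sent to the comorphism `{(v, 1)}`. -/
def fibreOp (A : 𝓑) : (p.Fiber A)ᵒᵖ ⥤ FibDual p where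
  obj X := of X.unop.1
  map v := mk (VhSpan.ofVertical v.unop.1 v.unop.2)
  map_id _ := rfl
  map_comp _ _ := (mk_comp_mk (VhSpan.ofVerticalIsComp _ _ _ _ _)).symm

end FibDual

end FibrewiseDual

/-! ### Manifolds and vector bundles -/

/-- A real `C^n` manifold, bundled with the model it is built on. -/
structure Mfd (n : ℕ∞ω) where
  carrier : Type u
  [top : TopologicalSpace carrier]
  {modelVec : Type u}
  [normed : NormedAddCommGroup modelVec]
  [space : NormedSpace ℝ modelVec]
  {modelSpace : Type u}
  [modelTop : TopologicalSpace modelSpace]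
  model : ModelWithCorners ℝ modelVec modelSpace
  [charted : ChartedSpace modelSpace carrier]
  [manifold : IsManifold model n carrier]

attribute [instance] Mfd.top Mfd.normed Mfd.space Mfd.modelTop Mfd.charted Mfd.manifold

variable {n : ℕ∞ω}

namespace Mfd

/-- Morphisms of manifolds: `C^n` maps. -/
@[ext]
structure Hom (M N : Mfd.{u} n) where
  map : C^n⟮M.model, M.carrier; N.model, N.carrier⟯

instance category : Category.{u} (Mfd.{u} n) where
  Hom := Hom
  id M := ⟨ContMDiffMap.id⟩
  comp f g := ⟨g.map.comp f.map⟩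

end Mfd

/-- A real `C^n` vector bundle of finite rank over `M`: fibres `E x`, locally trivial with typical
fibre `F`. -/
structure VBun (M : Mfd.{u} n) where
  F : Type u
  [normed : NormedAddCommGroup F]
  [space : NormedSpace ℝ F]
  [finite : FiniteDimensional ℝ F]
  E : M.carrier → Type u
  [addCommGroup : ∀ x, AddCommGroup (E x)]
  [module : ∀ x, Module ℝ (E x)]
  [fibreTop : ∀ x, TopologicalSpace (E x)]
  [topAddGroup : ∀ x, IsTopologicalAddGroup (E x)]
  [contSMul : ∀ x, ContinuousSMul ℝ (E x)]
  [totalTop : TopologicalSpace (TotalSpace F E)]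
  [fiberBundle : FiberBundle F E]
  [vectorBundle : VectorBundle ℝ F E]
  [smoothBundle : ContMDiffVectorBundle n F E M.model]

namespace VBun

attribute [instance] VBun.normed VBun.space VBun.finite VBun.addCommGroup VBun.module
  VBun.fibreTop VBun.topAddGroup VBun.contSMul VBun.totalTop VBun.fiberBundle
  VBun.vectorBundle VBun.smoothBundle

variable {M N K L : Mfd.{u} n}

/-- The total space of a vector bundle. -/
abbrev Total (X : VBun M) : Type u := TotalSpace X.F X.E

/-- A fibrewise linear `C^n` map from `X` to `Y` over the map `f` of base spaces. (In finite
dimensions continuity of the linear maps `lin a` is automatic.) -/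
@[ext]
structure HomOver (f : M.carrier → N.carrier) (X : VBun M) (Y : VBun N) where
  lin : ∀ a, X.E a →L[ℝ] Y.E (f a)
  smooth : ContMDiff (M.model.prod 𝓘(ℝ, X.F)) (N.model.prod 𝓘(ℝ, Y.F)) n
    (fun e : X.Total => (⟨f e.1, lin e.1 e.2⟩ : Y.Total))

namespace HomOver

/-- The map of total spaces. -/
def total {f : M.carrier → N.carrier} {X : VBun M} {Y : VBun N} (t : HomOver f X Y) :
    X.Total → Y.Total := fun e => ⟨f e.1, t.lin e.1 e.2⟩

def id (X : VBun M) : HomOver (fun a => a) X X where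
  lin _ := ContinuousLinearMap.id ℝ _
  smooth := contMDiff_id

def comp {f : M.carrier → N.carrier} {g : N.carrier → K.carrier} {X : VBun M} {Y : VBun N}
    {Z : VBun K} (t : HomOver f X Y) (s : HomOver g Y Z) : HomOver (fun a => g (f a)) X Z where
  lin a := (s.lin (f a)).comp (t.lin a)
  smooth := s.smooth.comp t.smooth

end HomOver

/-- Vector bundles over a fixed manifold `M`, with fibrewise linear maps over the identity. -/
instance category : Category.{u} (VBun M) where
  Hom X Y := HomOver (fun a => a) X Y
  id X := HomOver.id X
  comp t s := t.comp s

/-- The fibrewise linear dual: the fibre at `a` is the space of linear forms on `X.E a`, with the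
bundle structure for which the transposed inverses of trivializations are trivializations. -/
def dual (X : VBun M) : VBun M where
  F := X.F →L[ℝ] ℝ
  E := fun a => X.E a →L[ℝ] Trivial M.carrier ℝ a

/-- Evaluation of an element of the dual bundle. -/
def eval {X : VBun M} {a : M.carrier} (ξ : X.dual.E a) (x : X.E a) : ℝ :=
  (show X.E a →L[ℝ] ℝ from ξ) x

/-- In local trivializations, the matrix of a fibrewise linear `C^n` map depends `C^n` on the base
point. -/
theorem HomOver.contMDiffAt_inCoordinates {f : M.carrier → N.carrier} {X : VBun M} {Y : VBun N}
    (t : HomOver f X Y) (a₀ : M.carrier) :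
    ContMDiffAt M.model 𝓘(ℝ, X.F →L[ℝ] Y.F) n
      (fun a => ContinuousLinearMap.inCoordinates X.F X.E Y.F Y.E a₀ a (f a₀) (f a) (t.lin a))
      a₀ := by
  have hf : ContMDiffAt M.model N.model n f a₀ := by
    have h := (contMDiff_proj Y.E (IB := N.model)).comp
      (t.smooth.comp (contMDiff_zeroSection ℝ X.E (IB := M.model)))
    exact h a₀
  have hA : ∀ᶠ a in nhds a₀, a ∈ (trivializationAt X.F X.E a₀).baseSet :=
    (trivializationAt X.F X.E a₀).open_baseSet.mem_nhds (mem_baseSet_trivializationAt X.F X.E a₀)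
  have hB : ∀ᶠ a in nhds a₀, f a ∈ (trivializationAt Y.F Y.E (f a₀)).baseSet :=
    hf.continuousAt ((trivializationAt Y.F Y.E (f a₀)).open_baseSet.mem_nhds
      (mem_baseSet_trivializationAt Y.F Y.E (f a₀)))
  have key : ∀ v : X.F, ContMDiffAt M.model 𝓘(ℝ, Y.F) n
      (fun a => ContinuousLinearMap.inCoordinates X.F X.E Y.F Y.E a₀ a (f a₀) (f a) (t.lin a) v)
      a₀ := by
    intro v
    have h1 : ContMDiffAt M.model (M.model.prod 𝓘(ℝ, X.F)) n
        (fun a => (trivializationAt X.F X.E a₀).toOpenPartialHomeomorph.symm (a, v)) a₀ := by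
      have := (trivializationAt X.F X.E a₀).contMDiffOn_symm (IB := M.model) (n := n)
      refine ContMDiffAt.comp (x := a₀) (f := fun a : M.carrier => (a, v))
        (g := (trivializationAt X.F X.E a₀).toOpenPartialHomeomorph.symm) ?_
        (contMDiffAt_id.prodMk (contMDiffAt_const : ContMDiffAt M.model 𝓘(ℝ, X.F) n _ a₀))
      refine this.contMDiffAt ((trivializationAt X.F X.E a₀).open_target.mem_nhds ?_)
      rw [Trivialization.mem_target]
      exact hA.self_of_nhds
    have h2 := (t.smooth _).comp a₀ h1
    have hp : ((trivializationAt X.F X.E a₀).toOpenPartialHomeomorph.symm (a₀, v)).1 = a₀ :=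
      (trivializationAt X.F X.E a₀).proj_symm_apply
        ((Trivialization.mem_target _).2 hA.self_of_nhds)
    have h3 := (((trivializationAt Y.F Y.E (f a₀)).contMDiffAt_iff (by
      rw [Trivialization.mem_source]
      dsimp
      rw [hp]
      exact hB.self_of_nhds)).1 h2).2
    refine h3.congr_of_eventuallyEq ?_
    filter_upwards [hA, hB] with a ha hb
    rw [ContinuousLinearMap.inCoordinates_eq ha hb]
    have e : (trivializationAt X.F X.E a₀).toOpenPartialHomeomorph.symm (a, v) =
        ⟨a, (trivializationAt X.F X.E a₀).symm a v⟩ :=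
      ((trivializationAt X.F X.E a₀).mk_symm ha v).symm
    change _ = (trivializationAt Y.F Y.E (f a₀)
      (t.total ((trivializationAt X.F X.E a₀).toOpenPartialHomeomorph.symm (a, v)))).2
    rw [e]
    simp [total]
  let b := Module.finBasis ℝ X.F
  let Φ : (Fin (Module.finrank ℝ X.F) → Y.F) →L[ℝ] (X.F →L[ℝ] Y.F) :=
    LinearMap.toContinuousLinearMap
      ((b.constr ℝ).trans LinearMap.toContinuousLinearMap).toLinearMap
  have hΦ : ∀ L : X.F →L[ℝ] Y.F, Φ (fun i => L (b i)) = L := by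
    intro L
    ext x
    have : b.constr ℝ (fun i => L (b i)) = (L : X.F →ₗ[ℝ] Y.F) :=
      b.ext fun i => by simp
    change (b.constr ℝ (fun i => L (b i))) x = L x
    rw [this]
    rfl
  have h := (Φ.contMDiff (n := n)).contMDiffAt.comp a₀
    (contMDiffAt_pi_space.2 fun i => key (b i))
  refine h.congr_of_eventuallyEq (Filter.Eventually.of_forall fun a => ?_)
  exact (hΦ _).symm

theorem dual_smooth {X Y : VBun M} (t : X ⟶ Y) :
    ContMDiff (M.model.prod 𝓘(ℝ, Y.dual.F)) (M.model.prod 𝓘(ℝ, X.dual.F)) n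
      (fun e : Y.dual.Total => (⟨e.1, ContinuousLinearMap.comp
        (show Y.E e.1 →L[ℝ] Trivial M.carrier ℝ e.1 from e.2) (HomOver.lin t e.1)⟩ :
          X.dual.Total)) := by
  intro e₀
  have hid : ContMDiffAt (M.model.prod 𝓘(ℝ, Y.dual.F)) (M.model.prod 𝓘(ℝ, Y.dual.F)) n
      (fun e : Y.dual.Total => e) e₀ := contMDiffAt_id
  have h1 := ((contMDiffAt_hom_bundle (F₁ := Y.F) (E₁ := Y.E) (F₂ := ℝ)
    (E₂ := Trivial M.carrier ℝ) (IB := M.model) _).1 hid)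
  refine (contMDiffAt_hom_bundle (F₁ := X.F) (E₁ := X.E) (F₂ := ℝ)
    (E₂ := Trivial M.carrier ℝ) (IB := M.model) _).2 ⟨h1.1, ?_⟩
  have h2 := ((HomOver.contMDiffAt_inCoordinates t e₀.1).comp e₀ h1.1)
  refine (h1.2.clm_comp h2).congr_of_eventuallyEq ?_
  have hA : ∀ᶠ e : Y.dual.Total in nhds e₀,
      e.1 ∈ (trivializationAt X.F X.E e₀.1).baseSet :=
    h1.1.continuousAt ((trivializationAt X.F X.E e₀.1).open_baseSet.mem_nhds
      (mem_baseSet_trivializationAt X.F X.E e₀.1))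
  have hB : ∀ᶠ e : Y.dual.Total in nhds e₀,
      e.1 ∈ (trivializationAt Y.F Y.E e₀.1).baseSet :=
    h1.1.continuousAt ((trivializationAt Y.F Y.E e₀.1).open_baseSet.mem_nhds
      (mem_baseSet_trivializationAt Y.F Y.E e₀.1))
  filter_upwards [hA, hB] with e ha hb
  have hc : e.1 ∈ (trivializationAt ℝ (Trivial M.carrier ℝ) e₀.1).baseSet := by simp
  ext v
  simp only [Function.comp_apply, ContinuousLinearMap.inCoordinates_eq ha hb,
    ContinuousLinearMap.inCoordinates_eq ha hc, ContinuousLinearMap.inCoordinates_eq hb hc,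
    ContinuousLinearMap.comp_apply, ContinuousLinearEquiv.coe_coe,
    ContinuousLinearEquiv.symm_apply_apply]
  rfl

/-- The transpose `ξ ↦ ξ ∘ t` of a map of vector bundles over `M`. -/
def dualMap {X Y : VBun M} (t : X ⟶ Y) : Y.dual ⟶ X.dual where
  lin a := ContinuousLinearMap.precomp (Trivial M.carrier ℝ a) (HomOver.lin t a)
  smooth := dual_smooth t

variable (M) in
/-- The fibrewise linear dualization functor of vector bundles over `M`. -/
def dualFunctor : VBun M ⥤ (VBun M)ᵒᵖ where
  obj X := .op X.dual
  map t := (dualMap t).op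
  map_id _ := rfl
  map_comp _ _ := rfl

/-- The pullback of a vector bundle along a `C^n` map. -/
def pullback (f : M ⟶ N) (Y : VBun N) : VBun M :=
  letI g : C^n⟮M.model, M.carrier; N.model, N.carrier⟯ := f.map
  letI : ∀ x, AddCommGroup ((g *ᵖ Y.E) x) := fun x => inferInstanceAs (AddCommGroup (Y.E (g x)))
  haveI : ∀ x, IsTopologicalAddGroup ((g *ᵖ Y.E) x) :=
    fun x => inferInstanceAs (IsTopologicalAddGroup (Y.E (g x)))
  haveI : ∀ x, ContinuousSMul ℝ ((g *ᵖ Y.E) x) :=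
    fun x => inferInstanceAs (ContinuousSMul ℝ (Y.E (g x)))
  { F := Y.F
    E := g *ᵖ Y.E }

/-- The canonical map from the pullback of `Y` along `f` to `Y`. -/
def pullbackLift (f : M ⟶ N) (Y : VBun N) : HomOver f.map (pullback f Y) Y where
  lin a := ContinuousLinearMap.id ℝ (Y.E (f.map a))
  smooth := by
    intro e₀
    have hid : ContMDiffAt (M.model.prod 𝓘(ℝ, (pullback f Y).F))
      (M.model.prod 𝓘(ℝ, (pullback f Y).F)) n (fun e : (pullback f Y).Total => e) e₀ :=
      contMDiffAt_id
    rw [contMDiffAt_totalSpace] at hid ⊢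
    exact ⟨(f.map.contMDiff _).comp e₀ hid.1, hid.2⟩

/-- The universal property of the pullback of vector bundles. -/
def pullbackFactor {f : N ⟶ K} {Y : VBun K} {X : VBun M} (g : M ⟶ N)
    (t : HomOver (fun a => f.map (g.map a)) X Y) : HomOver g.map X (pullback f Y) where
  lin a := t.lin a
  smooth := by
    intro e₀
    have h := t.smooth e₀
    rw [contMDiffAt_totalSpace] at h ⊢
    exact ⟨(g.map.contMDiff _).comp e₀ (contMDiffAt_proj X.E), h.2⟩

end VBun

/-- The category of `C^n` vector bundles over the manifolds in a given full subcategory `P` of the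
category of manifolds: an object is a manifold with a vector bundle over it. -/
structure VB (P : ObjectProperty (Mfd.{u} n)) where
  base : P.FullSubcategory
  bundle : VBun base.obj

namespace VB

variable {P : ObjectProperty (Mfd.{u} n)}

/-- An arrow of vector bundles: a `C^n` map of base manifolds with a fibrewise linear `C^n` map of
total spaces over it. -/
@[ext]
structure Hom (X Y : VB P) where
  base : X.base ⟶ Y.base
  fib : VBun.HomOver base.hom.map X.bundle Y.bundle

instance category : Category.{u} (VB P) where
  Hom := Hom
  id X := ⟨𝟙 X.base, VBun.HomOver.id X.bundle⟩
  comp t s := ⟨t.base ≫ s.base, t.fib.comp s.fib⟩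

variable (P) in
/-- The projection to the base category. -/
def proj : VB P ⥤ P.FullSubcategory where
  obj X := X.base
  map t := Hom.base t

/-- The category of vector bundles is fibred over the base category. -/
instance : (proj P).IsFibered := by
  refine IsFibered.of_exists_isStronglyCartesian fun Y A f => ?_
  let lift : (⟨A, VBun.pullback f.hom Y.bundle⟩ : VB P) ⟶ Y :=
    ⟨f, VBun.pullbackLift f.hom Y.bundle⟩
  have hl : (proj P).IsHomLift f lift := CategoryTheory.IsHomLift.map (proj P) lift
  refine ⟨_, lift, { universal_property' := ?_ }⟩
  intro X g t ht
  obtain ⟨b, o⟩ := t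
  have hb : g ≫ f = b := CategoryTheory.IsHomLift.eq_of_isHomLift (proj P) (g ≫ f) (⟨b, o⟩ : X ⟶ Y)
  subst hb
  let χ : X ⟶ (⟨A, VBun.pullback f.hom Y.bundle⟩ : VB P) := ⟨g, VBun.pullbackFactor g.hom o⟩
  have hχ : (proj P).IsHomLift g χ := CategoryTheory.IsHomLift.map (proj P) χ
  refine ⟨χ, ⟨hχ, rfl⟩, ?_⟩
  rintro χ' ⟨h1, h2⟩
  have hb : g = Hom.base χ' := @CategoryTheory.IsHomLift.eq_of_isHomLift _ _ _ _ (proj P) _ _ g χ' h1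
  obtain ⟨b', o'⟩ := χ'
  subst hb
  have h3 : VBun.HomOver.comp o' (VBun.pullbackLift f.hom Y.bundle) = o :=
    eq_of_heq (Hom.mk.inj h2).2
  subst h3
  rfl

/-- Vector bundles over a fixed base manifold, as a subcategory of all vector bundles. -/
def ofFibre (A : P.FullSubcategory) : VBun A.obj ⥤ VB P where
  obj X := ⟨A, X⟩
  map t := ⟨𝟙 A, t⟩
  map_comp t s := Hom.ext (Category.comp_id (𝟙 A)).symm HEq.rfl

/-- Vector bundles over `A` form the fibre over `A` of the projection. -/
def toFibre (A : P.FullSubcategory) : VBun A.obj ⥤ (proj P).Fiber A :=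
  Fiber.inducedFunctor (F := ofFibre A)
    (CategoryTheory.Functor.ext (fun _ => rfl) (fun _ _ _ => by simp; rfl))

/-- The fibrewise linear dual. -/
def dual (X : VB P) : VB P := ⟨X.base, X.bundle.dual⟩

/-- `c` is the comorphism between the dual bundles given by transposing the fibre maps
`t_a : X_a → Y_{t a}` of `t`: it has a representing vh span over the base map of `t`, with arrows
`v : W → X†` and `h : W → Y†`, such that `v w = h w ∘ t_a` for each `w` in the fibre of `W` whose
image in `X†` lies over `a`. -/
def IsTranspose {X Y : VB P} (t : X ⟶ Y)
    (c : (FibDual.of X.dual : FibDual (proj P)) ⟶ FibDual.of Y.dual) : Prop :=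
  ∃ s : VhSpan (proj P) X.dual Y.dual, FibDual.mk s = c ∧ s.base = Hom.base t ∧
    ∀ (b : s.apex.base.obj.carrier) (w : s.apex.bundle.E b)
      (x : X.bundle.E ((Hom.base s.vert).hom.map b))
      (y : Y.bundle.E ((Hom.base s.horiz).hom.map b)),
      (Hom.fib t).total ⟨_, x⟩ = ⟨_, y⟩ →
        VBun.eval ((Hom.fib s.vert).lin b w) x = VBun.eval ((Hom.fib s.horiz).lin b w) y

/-- `D` sends each vector bundle to its dual and each arrow to the transposed comorphism. -/
structure IsFibrewiseDual (D : VB P ⥤ FibDual (proj P)) : Prop where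
  obj : ∀ X, D.obj X = FibDual.of X.dual
  map : ∀ {X Y : VB P} (t : X ⟶ Y),
    IsTranspose t (eqToHom (obj X).symm ≫ D.map t ≫ eqToHom (obj Y))

end VB

end

/-! Let `t : X ⟶ Y` lie over `f`. It factors as a vertical arrow `X ⟶ f^*Y` followed by the
canonical arrow of the pullback. Transposing the vertical factor gives `(f^*Y)† ⟶ X†`. The fibres of
`(f^*Y)†` are those of `Y†` along `f`, and by `inCoordinates_dual_pullback` the coordinates agree
too, so the evident arrow `(f^*Y)† ⟶ Y†` is Cartesian over `f`. These two arrows form `transposeSpan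
t`.

Everything else about the functor rests on `IsTranspose.unique`. Two transposes of `t` are
represented by spans whose Cartesian legs lie over the same `f`, so a vertical isomorphism of apices
matches these legs. It then matches the vertical legs as well, because the transposition formula
expresses their values through the Cartesian legs and a linear form is determined by its values.
Functoriality, agreement with `†` on fibres and uniqueness of `D` are thus reduced to recognizing
transposes: identities, composites and the comorphisms `{(t†, 1)}`.

For preservation of Cartesian arrows, a Cartesian `t` is an isomorphism followed by a canonical
pullback arrow. The transposed span of the latter has an identity as vertical leg, and a comorphism
with invertible vertical leg is Cartesian (`isStronglyCartesian_mk`). -/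

noncomputable section

/-! ### Cartesian arrows of the fibrewise dual -/

namespace FibDual

variable {𝒳 : Type u₁} {𝓑 : Type u₂} [Category.{v₁} 𝒳] [Category.{v₂} 𝓑] {p : 𝒳 ⥤ 𝓑}

/-- The legs of a vh span lie over a commutative triangle. -/
theorem _root_.VhSpan.map_vert_comp_base {X Y : 𝒳} (s : VhSpan p X Y) :
    p.map s.vert ≫ s.base = p.map s.horiz := by
  rw [IsHomLift.fac' p (𝟙 (p.obj X)) s.vert, IsHomLift.fac' p s.base s.horiz]
  simp

variable [p.IsFibered]

theorem eq_base_of_isHomLift {X Y : 𝒳} {f : p.obj X ⟶ p.obj Y} {s : VhSpan p X Y}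
    (h : (proj p).IsHomLift f (mk s)) : f = s.base :=
  @IsHomLift.eq_of_isHomLift _ _ _ _ (proj p) (of X) (of Y) f (mk s) h

/-- A comorphism whose vertical part is invertible is Cartesian. -/
theorem isStronglyCartesian_mk {X Y : 𝒳} (s : VhSpan p X Y) [IsIso s.vert] :
    (proj p).IsStronglyCartesian s.base (mk s) := by
  have hs : (proj p).IsHomLift s.base (mk s) := IsHomLift.map (proj p) (mk s)
  refine { universal_property' := ?_ }
  rintro ⟨Z⟩ g c hc
  change p.obj Z ⟶ p.obj X at g
  obtain ⟨r, rfl⟩ : ∃ r, mk r = c := Quotient.exists_rep c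
  have hr : g ≫ s.base = r.base := eq_base_of_isHomLift hc
  have hrc : p.IsStronglyCartesian (g ≫ s.base) r.horiz := hr ▸ r.cartesian
  obtain ⟨k, ⟨hkl, hk⟩, -⟩ :=
    IsStronglyCartesian.universal_property p s.base s.horiz g (g ≫ s.base) rfl r.horiz
  have hkc : p.IsStronglyCartesian g k := by
    have : p.IsStronglyCartesian (g ≫ s.base) (k ≫ s.horiz) := by rw [hk]; exact hrc
    exact IsStronglyCartesian.of_comp p (g := s.base) (ψ := s.horiz)
  -- Being vertical and invertible, `s.vert` is Cartesian. Hence `k ≫ s.vert` can serve as the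
  -- horizontal leg of the factorization `χ`; without this `χ` would not be a vh span.
  have hvc : p.IsStronglyCartesian (𝟙 (p.obj X)) s.vert := inferInstance
  have hkv : p.IsStronglyCartesian g (k ≫ s.vert) := by
    have : p.IsStronglyCartesian (g ≫ 𝟙 (p.obj X)) (k ≫ s.vert) := inferInstance
    rwa [Category.comp_id] at this
  let χ : VhSpan p Z X := ⟨g, r.apex, r.vert, k ≫ s.vert, r.vertical, hkv⟩
  have hχ : VhSpan.IsComp χ s r :=
    { w := 𝟙 r.apex
      k := k
      vertical := IsHomLift.id (IsHomLift.domain_eq p (𝟙 (p.obj Z)) r.vert)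
      cartesian := hkc
      sq := (Category.id_comp _).symm
      vert_eq := Category.id_comp _
      horiz_eq := hk }
  refine ⟨mk χ, ⟨IsHomLift.map (proj p) (mk χ), mk_comp_mk hχ⟩, ?_⟩
  rintro c ⟨hc, hcs⟩
  obtain ⟨q, rfl⟩ : ∃ q, mk q = c := Quotient.exists_rep c
  obtain rfl : g = q.base := eq_base_of_isHomLift hc
  have C := q.compIsComp s
  have := C.vertical
  have := C.cartesian
  obtain ⟨i, hi, hi1, hi2⟩ := Quotient.exact ((mk_comp_mk C).symm.trans hcs)
  have hi : p.IsHomLift (𝟙 (p.obj Z)) i.hom := hi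
  -- The square of the composite reads `C.k ≫ s.vert = C.w ≫ q.horiz`. The left side is Cartesian,
  -- so `C.w` is Cartesian over an identity, hence invertible. This lets `i`, which compares the
  -- composites with `s`, be carried back to the apex of `q`.
  have hWc : p.IsStronglyCartesian (𝟙 (p.obj Z)) C.w := by
    have h : p.IsStronglyCartesian (q.base ≫ 𝟙 (p.obj X)) (C.k ≫ s.vert) := inferInstance
    rw [C.sq, Category.comp_id] at h
    have h' : p.IsStronglyCartesian (𝟙 (p.obj Z) ≫ q.base) (C.w ≫ q.horiz) := by
      rwa [Category.id_comp]
    exact IsStronglyCartesian.of_comp p (g := q.base) (ψ := q.horiz)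
  have hW : IsIso C.w := IsStronglyCartesian.isIso_of_base_isIso p (𝟙 (p.obj Z)) C.w
  -- Both sides lie over `q.base` and agree after the Cartesian arrow `s.horiz`.
  have hik : i.hom ≫ k = C.k := by
    have h : p.IsHomLift (𝟙 (p.obj Z) ≫ q.base) (i.hom ≫ k) :=
      IsHomLift.comp p (𝟙 (p.obj Z)) q.base i.hom k
    rw [Category.id_comp] at h
    refine IsStronglyCartesian.ext p s.base s.horiz q.base ?_
    rw [Category.assoc, hk, hi2, C.horiz_eq]
  refine Quotient.sound ⟨(asIso C.w).symm ≪≫ i, ?_, ?_, ?_⟩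
  · have : p.IsHomLift (𝟙 (p.obj Z)) (inv C.w) := inferInstance
    exact (inferInstance : p.IsHomLift (𝟙 (p.obj Z)) (inv C.w ≫ i.hom))
  · change (inv C.w ≫ i.hom) ≫ r.vert = q.vert
    rw [Category.assoc, hi1, ← C.vert_eq, IsIso.inv_hom_id_assoc]
  · change (inv C.w ≫ i.hom) ≫ k ≫ s.vert = q.horiz
    rw [Category.assoc, ← Category.assoc i.hom, hik, C.sq, IsIso.inv_hom_id_assoc]

end FibDual

variable {n : ℕ∞ω}

/-! ### Pairing with the dual, and the dual of a pullback -/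

namespace VBun

variable {M N K : Mfd.{u} n}

open Classical in
/-- The pairing of points of the total spaces of `X†` and `X`, zero if they lie over different
points of the base. -/
def pairing {X : VBun M} (ξ : X.dual.Total) (x : X.Total) : ℝ :=
  -- The default is harmless: the pairing is only used at points over the same base point. Being
  -- defined on total spaces, it needs no transport between fibres whose base points agree only
  -- propositionally.
  if h : x.1 = ξ.1 then eval ξ.2 (h ▸ x.2) else 0

theorem pairing_mk {X : VBun M} {a : M.carrier} (ξ : X.dual.E a) (x : X.E a) :
    pairing (⟨a, ξ⟩ : X.dual.Total) ⟨a, x⟩ = eval ξ x := by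
  simp [pairing]

theorem pairing_ext {X : VBun M} {ξ ξ' : X.dual.Total} (h : ξ.1 = ξ'.1)
    (H : ∀ x : X.Total, x.1 = ξ.1 → pairing ξ x = pairing ξ' x) : ξ = ξ' := by
  obtain ⟨a, ξ⟩ := ξ
  obtain ⟨a', ξ'⟩ := ξ'
  obtain rfl : a = a' := h
  congr 1
  refine ContinuousLinearMap.ext fun x => ?_
  have := H ⟨a, x⟩ rfl
  rwa [pairing_mk, pairing_mk] at this


/-- The preferred trivialization of `f^*Y` at `a₀` is pulled back from that of `Y` at `f a₀`. Off
the base set both sides are zero by convention, so no condition on `a` is needed. -/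
theorem symmL_pullback (f : M ⟶ N) (Y : VBun N) (a₀ a : M.carrier) :
    (trivializationAt (pullback f Y).F (pullback f Y).E a₀).symmL ℝ a =
      (trivializationAt Y.F Y.E (f.map a₀)).symmL ℝ (f.map a) := by
  refine ContinuousLinearMap.ext fun v => ?_
  by_cases h : f.map a ∈ (trivializationAt Y.F Y.E (f.map a₀)).baseSet
  · have h' : a ∈ (trivializationAt (pullback f Y).F (pullback f Y).E a₀).baseSet := h
    refine (Trivialization.symmL_apply _ h' v).trans
      (Eq.trans ?_ (Trivialization.symmL_apply _ h v).symm)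
    exact eq_of_heq (TotalSpace.mk.inj (Trivialization.mk_symm _ h' v)).2
  · have h' : a ∉ (trivializationAt (pullback f Y).F (pullback f Y).E a₀).baseSet := h
    exact (Trivialization.symmL_apply_of_notMem _ h' v).trans
      (Trivialization.symmL_apply_of_notMem _ h v).symm

/-- The trivial line bundle contributes nothing to the coordinates, so only `symmL_pullback`
matters. This is how `(f^*Y)†` acquires the universal property of `f^*(Y†)` without comparing the
two bundles. -/
theorem inCoordinates_dual_pullback (f : M ⟶ N) (Y : VBun N) (a₀ a : M.carrier)
    (ξ : (pullback f Y).dual.E a) :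
    ContinuousLinearMap.inCoordinates (pullback f Y).F (pullback f Y).E ℝ (Trivial M.carrier ℝ)
      a₀ a a₀ a ξ =
    ContinuousLinearMap.inCoordinates Y.F Y.E ℝ (Trivial N.carrier ℝ)
      (f.map a₀) (f.map a) (f.map a₀) (f.map a) ξ := by
  unfold ContinuousLinearMap.inCoordinates
  rw [symmL_pullback]
  simp
  rfl

/-- The canonical map from the dual of the pullback of `Y` along `f` to the dual of `Y`. -/
def dualPullbackLift (f : M ⟶ N) (Y : VBun N) : HomOver f.map (pullback f Y).dual Y.dual where
  lin a := ContinuousLinearMap.id ℝ (Y.dual.E (f.map a))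
  smooth := by
    intro e₀
    have hid : ContMDiffAt (M.model.prod 𝓘(ℝ, (pullback f Y).dual.F))
      (M.model.prod 𝓘(ℝ, (pullback f Y).dual.F)) n (fun e : (pullback f Y).dual.Total => e) e₀ :=
      contMDiffAt_id
    have h := (contMDiffAt_hom_bundle (F₁ := (pullback f Y).F) (E₁ := (pullback f Y).E) (F₂ := ℝ)
      (E₂ := Trivial M.carrier ℝ) (IB := M.model) _).1 hid
    exact (contMDiffAt_hom_bundle (F₁ := Y.F) (E₁ := Y.E) (F₂ := ℝ)
      (E₂ := Trivial N.carrier ℝ) (IB := N.model) _).2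
        ⟨(f.map.contMDiff _).comp e₀ h.1, h.2.congr_of_eventuallyEq
          (.of_forall fun e => (inCoordinates_dual_pullback f Y e₀.1 e.1 e.2).symm)⟩

/-- The universal property of the dual of a pullback, as the pullback of the dual. -/
def dualPullbackFactor {f : N ⟶ K} {Y : VBun K} {X : VBun M} (g : M ⟶ N)
    (t : HomOver (fun a => f.map (g.map a)) X Y.dual) : HomOver g.map X (pullback f Y).dual where
  lin a := t.lin a
  smooth := by
    intro e₀
    have h := (contMDiffAt_hom_bundle (F₁ := Y.F) (E₁ := Y.E) (F₂ := ℝ)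
      (E₂ := Trivial K.carrier ℝ) (IB := K.model) _).1 (t.smooth e₀)
    exact (contMDiffAt_hom_bundle (F₁ := (pullback f Y).F) (E₁ := (pullback f Y).E) (F₂ := ℝ)
      (E₂ := Trivial N.carrier ℝ) (IB := N.model) _).2
        ⟨(g.map.contMDiff _).comp e₀ (contMDiffAt_proj X.E), h.2.congr_of_eventuallyEq
          (.of_forall fun e => inCoordinates_dual_pullback f Y _ (g.map e.1) (t.lin e.1 e.2))⟩

end VBun

/-! ### Equality of bundle maps and a criterion for Cartesian arrows -/

namespace VB

variable {P : ObjectProperty (Mfd.{u} n)} {X Y Z : VB P}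

/-- The map of total spaces. -/
def total (t : X ⟶ Y) : X.bundle.Total → Y.bundle.Total := (Hom.fib t).total

theorem total_comp (t : X ⟶ Y) (s : Y ⟶ Z) (x : X.bundle.Total) :
    total (t ≫ s) x = total s (total t x) := rfl

theorem hom_ext {t s : X ⟶ Y} (h : Hom.base t = Hom.base s) (H : ∀ x, total t x = total s x) :
    t = s := by
  obtain ⟨b, t⟩ := t
  obtain ⟨c, s⟩ := s
  obtain rfl : b = c := h
  congr 1
  ext a x
  exact eq_of_heq (TotalSpace.mk.inj (H ⟨a, x⟩)).2

/-- An arrow over `f` is Cartesian if arrows over composites with `f` factor uniquely through it. -/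
theorem isStronglyCartesian_of_existsUnique {A : P.FullSubcategory} {W : VBun A.obj}
    (f : A ⟶ Y.base) (l : VBun.HomOver f.hom.map W Y.bundle)
    (H : ∀ (X : VB P) (g : X.base ⟶ A)
      (o : VBun.HomOver (fun a => f.hom.map (g.hom.map a)) X.bundle Y.bundle),
      ∃! o' : VBun.HomOver g.hom.map X.bundle W, o'.comp l = o) :
    (proj P).IsStronglyCartesian f (⟨f, l⟩ : (⟨A, W⟩ : VB P) ⟶ Y) := by
  have hl : (proj P).IsHomLift f (⟨f, l⟩ : (⟨A, W⟩ : VB P) ⟶ Y) :=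
    IsHomLift.map (proj P) (⟨f, l⟩ : (⟨A, W⟩ : VB P) ⟶ Y)
  refine { universal_property' := ?_ }
  intro X g t ht
  obtain ⟨b, o⟩ := t
  -- Lying over `g ≫ f` fixes the base map of the arrow, which leaves a question about the fibre
  -- maps alone.
  have hb : g ≫ f = b := @IsHomLift.eq_of_isHomLift _ _ _ _ (proj P) X Y (g ≫ f) ⟨b, o⟩ ht
  subst hb
  obtain ⟨o', ho', hu⟩ := H X g o
  refine ⟨⟨g, o'⟩, ⟨IsHomLift.map (proj P) (⟨g, o'⟩ : X ⟶ ⟨A, W⟩),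
    Hom.ext rfl (heq_of_eq ho')⟩, ?_⟩
  rintro ⟨b', o''⟩ ⟨h1, h2⟩
  have hb : g = b' := @IsHomLift.eq_of_isHomLift _ _ _ _ (proj P) X ⟨A, W⟩ g ⟨b', o''⟩ h1
  subst hb
  rw [hu o'' (eq_of_heq (Hom.mk.inj h2).2)]

/-! ### Transposed comorphisms: existence, composition, uniqueness -/

/-- The span `X† ← (f^*Y)† → Y†` of the transposed fibre maps of `t`, where `f` is the base map
of `t`. -/
def transposeSpan (t : X ⟶ Y) : VhSpan (proj P) X.dual Y.dual where
  base := Hom.base (X := X) (Y := Y) t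
  apex := ⟨X.base, (VBun.pullback (Hom.base (X := X) (Y := Y) t).hom Y.bundle).dual⟩
  -- Factoring along `𝟙` reads `t` as a map `X ⟶ f^*Y` over the identity, which can be dualized
  -- within the fibre.
  vert := (ofFibre X.base).map
    (VBun.dualMap (VBun.pullbackFactor (f := (Hom.base (X := X) (Y := Y) t).hom) (𝟙 X.base.obj) (Hom.fib t)))
  horiz := ⟨Hom.base (X := X) (Y := Y) t, VBun.dualPullbackLift (Hom.base (X := X) (Y := Y) t).hom Y.bundle⟩
  vertical := IsHomLift.map (proj P) ((ofFibre X.base).map _)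
  cartesian := isStronglyCartesian_of_existsUnique (Y := Y.dual) _ _ fun _ g o =>
    ⟨VBun.dualPullbackFactor g.hom o, rfl, fun _ h => by subst h; rfl⟩

/-- The span `s` is a span of transposed fibre maps of `t`. -/
def IsTransposeSpan (t : X ⟶ Y) (s : VhSpan (proj P) X.dual Y.dual) : Prop :=
  s.base = Hom.base t ∧ ∀ (w : s.apex.bundle.Total) (x : X.bundle.Total),
    x.1 = (total s.vert w).1 →
      VBun.pairing (X := X.bundle) (total s.vert w) x =
        VBun.pairing (X := Y.bundle) (total s.horiz w) (total t x)

/-- The commutative triangle under a vh span puts `t x` over the same point as the image of `w` in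
`Y†`. Hence the `y` in `IsTranspose` always exists, and the formula can be stated on total spaces.
-/
theorem isTranspose_iff (t : X ⟶ Y)
    (c : (FibDual.of X.dual : FibDual (proj P)) ⟶ FibDual.of Y.dual) :
    IsTranspose t c ↔ ∃ s, FibDual.mk s = c ∧ IsTransposeSpan t s := by
  refine exists_congr fun s => and_congr_right fun _ => and_congr_right fun hb =>
    ⟨fun H => ?_, fun H => ?_⟩
  · rintro ⟨b, w⟩ ⟨a, x⟩ h
    obtain rfl : a = (Hom.base s.vert).hom.map b := h
    have hh : (Hom.base t).hom.map ((Hom.base s.vert).hom.map b) =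
        (Hom.base s.horiz).hom.map b := by
      have := s.map_vert_comp_base
      rw [hb] at this
      exact congrArg (fun φ : s.apex.base ⟶ Y.base => φ.hom.map b) this
    -- The two base points are only propositionally equal; generalizing one of them allows `hh` to
    -- be substituted.
    obtain ⟨y, hy⟩ : ∃ y : Y.bundle.E ((Hom.base s.horiz).hom.map b),
        total t ⟨_, x⟩ = ⟨_, y⟩ := by
      generalize (Hom.base s.horiz).hom.map b = c at hh
      subst hh
      exact ⟨_, rfl⟩
    rw [hy]
    exact (VBun.pairing_mk _ _).trans ((H b w x y hy).trans (VBun.pairing_mk _ _).symm)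
  · intro b w x y hy
    have := H ⟨b, w⟩ ⟨_, x⟩ rfl
    rw [show total t ⟨_, x⟩ = ⟨_, y⟩ from hy] at this
    exact (VBun.pairing_mk _ _).symm.trans (this.trans (VBun.pairing_mk _ _))

theorem isTransposeSpan_transposeSpan (t : X ⟶ Y) : IsTransposeSpan t (transposeSpan t) := by
  refine ⟨rfl, ?_⟩
  rintro ⟨b, w⟩ ⟨a, x⟩ h
  obtain rfl : a = b := h
  exact (VBun.pairing_mk _ _).trans (VBun.pairing_mk (X := Y.bundle) _ _).symm

/-- Apply the formula for `s` at the image of `w` in its apex, cross the commutative square of the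
composite, then apply the formula for `s'` to `t x`. -/
theorem IsTransposeSpan.comp {t : X ⟶ Y} {t' : Y ⟶ Z} {s : VhSpan (proj P) X.dual Y.dual}
    {s' : VhSpan (proj P) Y.dual Z.dual} (h : IsTransposeSpan t s) (h' : IsTransposeSpan t' s') :
    IsTransposeSpan (t ≫ t') (s.comp s') := by
  obtain ⟨hb, H⟩ := h
  obtain ⟨hb', H'⟩ := h'
  refine ⟨congrArg₂ (fun (f : X.base ⟶ Y.base) (g : Y.base ⟶ Z.base) => f ≫ g) hb hb', fun w x hx => ?_⟩
  have hsq : total s'.vert (total (s.compK s') w) = total s.horiz (total (s.compW s') w) :=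
    congrArg (fun φ => total φ w) (VhSpan.compW_horiz s s').symm
  refine (H (total (s.compW s') w) x hx).trans ?_
  rw [← hsq]
  refine H' (total (s.compK s') w) (total t x) ?_
  -- What remains is that `t x` lies over the right base point, which again comes from the triangle
  -- under `s`.
  have e := s.map_vert_comp_base
  rw [hb] at e
  have e' := congrArg (fun φ : s.apex.base ⟶ Y.base => φ.hom.map (total (s.compW s') w).1) e
  have hx' : x.1 = (Hom.base s.vert).hom.map (total (s.compW s') w).1 := hx
  rw [hsq]
  exact (congrArg (Hom.base t).hom.map hx').trans e'

theorem IsTranspose.comp {t : X ⟶ Y} {t' : Y ⟶ Z}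
    {c : (FibDual.of X.dual : FibDual (proj P)) ⟶ FibDual.of Y.dual}
    {c' : (FibDual.of Y.dual : FibDual (proj P)) ⟶ FibDual.of Z.dual}
    (h : IsTranspose t c) (h' : IsTranspose t' c') : IsTranspose (t ≫ t') (c ≫ c') := by
  rw [isTranspose_iff] at *
  obtain ⟨s, rfl, hs⟩ := h
  obtain ⟨s', rfl, hs'⟩ := h'
  exact ⟨s.comp s', rfl, hs.comp hs'⟩

/-- The transposed comorphism is unique. -/
theorem IsTranspose.unique {t : X ⟶ Y}
    {c c' : (FibDual.of X.dual : FibDual (proj P)) ⟶ FibDual.of Y.dual}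
    (h : IsTranspose t c) (h' : IsTranspose t c') : c = c' := by
  rw [isTranspose_iff] at *
  obtain ⟨s, rfl, hb, H⟩ := h
  obtain ⟨s', rfl, hb', H'⟩ := h'
  have hs : (proj P).IsStronglyCartesian (Hom.base t) s.horiz := hb ▸ s.cartesian
  have hs' : (proj P).IsStronglyCartesian (Hom.base t) s'.horiz := hb' ▸ s'.cartesian
  let e := IsCartesian.domainUniqueUpToIso (proj P) (Hom.base t) s'.horiz s.horiz
  have he1 : e.hom ≫ s'.horiz = s.horiz := IsCartesian.fac (proj P) (Hom.base t) s'.horiz _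
  have he : (proj P).IsHomLift (𝟙 ((proj P).obj X.dual)) e.hom :=
    IsCartesian.domainUniqueUpToIso_inv_isHomLift (proj P) (Hom.base t) s'.horiz s.horiz
  have hbase : Hom.base (e.hom ≫ s'.vert) = Hom.base s.vert := by
    change (proj P).map (e.hom ≫ s'.vert) = (proj P).map s.vert
    rw [IsHomLift.fac' (proj P) (𝟙 ((proj P).obj X.dual)) (e.hom ≫ s'.vert),
      IsHomLift.fac' (proj P) (𝟙 ((proj P).obj X.dual)) s.vert]
  refine Quotient.sound ⟨e, he, hom_ext hbase fun w => ?_, he1⟩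
  have h1 : (total (e.hom ≫ s'.vert) w).1 = (total s.vert w).1 :=
    congrArg (fun φ : s.apex.base ⟶ X.base => φ.hom.map w.1) hbase
  -- Both vertical legs pair with `x` to the pairing of the same point of `Y†` with `t x`, since `e`
  -- matches the horizontal legs.
  refine VBun.pairing_ext (X := X.bundle) h1 fun x hx => ?_
  refine (H' (total e.hom w) x hx).trans ((H w x (hx.trans h1)).trans ?_).symm
  rw [← total_comp, he1]

theorem isTranspose_mk_transposeSpan (t : X ⟶ Y) :
    IsTranspose t (FibDual.mk (transposeSpan t)) :=
  (isTranspose_iff _ _).2 ⟨_, rfl, isTransposeSpan_transposeSpan t⟩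

/-- The transposed comorphism of a vertical arrow is its dual. -/
theorem isTranspose_ofFibre_map {A : P.FullSubcategory} {X Y : VBun A.obj} (t : X ⟶ Y) :
    IsTranspose ((ofFibre A).map t) ((FibDual.fibreOp (proj P) A).map
      ((toFibre A).map (VBun.dualMap t)).op) := by
  refine ⟨_, rfl, rfl, ?_⟩
  intro b w x y h
  obtain rfl : VBun.HomOver.lin t b x = y := eq_of_heq (TotalSpace.mk.inj h).2
  rfl

theorem isTranspose_id (X : VB P) :
    IsTranspose (𝟙 X) (𝟙 (FibDual.of X.dual : FibDual (proj P))) := by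
  refine ⟨VhSpan.id (proj P) X.dual, rfl, rfl, ?_⟩
  intro b w x y h
  obtain rfl : x = y := eq_of_heq (TotalSpace.mk.inj h).2
  rfl

/-! ### The dualization functor and its uniqueness -/

variable (P) in
/-- The fibrewise dualization functor. -/
def fibrewiseDual : VB P ⥤ FibDual (proj P) where
  obj X := FibDual.of X.dual
  map t := FibDual.mk (transposeSpan t)
  map_id X := (isTranspose_mk_transposeSpan (𝟙 X)).unique (isTranspose_id X)
  map_comp t s := (isTranspose_mk_transposeSpan (t ≫ s)).unique
    ((isTranspose_mk_transposeSpan t).comp (isTranspose_mk_transposeSpan s))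

theorem fibrewiseDual_comp_proj : fibrewiseDual P ⋙ FibDual.proj (proj P) = proj P := rfl

theorem ofFibre_comp_fibrewiseDual (A : P.FullSubcategory) :
    ofFibre A ⋙ fibrewiseDual P =
      VBun.dualFunctor A.obj ⋙ (toFibre A).op ⋙ FibDual.fibreOp (proj P) A :=
  CategoryTheory.Functor.hext (fun _ => rfl) fun _ _ t => heq_of_eq
    ((isTranspose_mk_transposeSpan ((ofFibre A).map t)).unique (isTranspose_ofFibre_map t))

theorem isFibrewiseDual_fibrewiseDual : IsFibrewiseDual (fibrewiseDual P) where
  obj _ := rfl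
  map t := by
    have h := isTranspose_mk_transposeSpan t
    rw [← Category.id_comp (FibDual.mk (transposeSpan t)),
      ← Category.comp_id (FibDual.mk (transposeSpan t))] at h
    exact h

theorem IsFibrewiseDual.eq_fibrewiseDual {D : VB P ⥤ FibDual (proj P)}
    (hD : IsFibrewiseDual D) : D = fibrewiseDual P := by
  refine CategoryTheory.Functor.ext hD.obj fun X Y t => ?_
  -- The object equalities are made variable so that they can be substituted, which is impossible
  -- for `D.obj X = _` itself.
  have key : ∀ {A A' B B' : FibDual (proj P)} (hA : A = A') (hB : B = B') {f : A ⟶ B}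
      {g : A' ⟶ B'}, eqToHom hA.symm ≫ f ≫ eqToHom hB = g →
        f = eqToHom hA ≫ g ≫ eqToHom hB.symm := by
    rintro _ _ _ _ rfl rfl f g h
    simpa using h
  exact key (hD.obj X) (hD.obj Y) ((hD.map t).unique (isTranspose_mk_transposeSpan t))

/-! ### Preservation of Cartesian arrows -/

/-- The canonical arrow from a pullback. -/
def pullbackLift {A : P.FullSubcategory} (f : A ⟶ Y.base) :
    (⟨A, VBun.pullback f.hom Y.bundle⟩ : VB P) ⟶ Y :=
  ⟨f, VBun.pullbackLift f.hom Y.bundle⟩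

theorem isStronglyCartesian_pullbackLift {A : P.FullSubcategory} (f : A ⟶ Y.base) :
    (proj P).IsStronglyCartesian f (pullbackLift f) :=
  isStronglyCartesian_of_existsUnique f _ fun _ g o =>
    ⟨VBun.pullbackFactor g.hom o, rfl, fun _ h => by subst h; rfl⟩

theorem isStronglyCartesian_fibrewiseDual_pullbackLift {A : P.FullSubcategory} (f : A ⟶ Y.base) :
    (FibDual.proj (proj P)).IsStronglyCartesian f ((fibrewiseDual P).map (pullbackLift f)) := by
  -- Factoring the canonical arrow through its own pullback gives the identity, whose transpose is
  -- definitionally an identity.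
  have : IsIso (transposeSpan (pullbackLift f)).vert :=
    inferInstanceAs (IsIso (𝟙 (⟨A, (VBun.pullback f.hom Y.bundle).dual⟩ : VB P)))
  exact FibDual.isStronglyCartesian_mk (transposeSpan (pullbackLift f))

theorem isStronglyCartesian_fibrewiseDual_map (t : X ⟶ Y)
    (ht : (proj P).IsStronglyCartesian ((proj P).map t) t) :
    (FibDual.proj (proj P)).IsStronglyCartesian
      ((FibDual.proj (proj P)).map ((fibrewiseDual P).map t)) ((fibrewiseDual P).map t) := by
  have hl := isStronglyCartesian_pullbackLift (Y := Y) (Hom.base t)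
  have hDl := isStronglyCartesian_fibrewiseDual_pullbackLift (Y := Y) (Hom.base t)
  have ht : (proj P).IsStronglyCartesian (Hom.base t) t := ht
  let e := IsCartesian.domainUniqueUpToIso (proj P) (Hom.base t) (pullbackLift (Hom.base t)) t
  have he : (proj P).IsHomLift (𝟙 X.base) e.hom :=
    IsCartesian.domainUniqueUpToIso_inv_isHomLift (proj P) (Hom.base t)
      (pullbackLift (Hom.base t)) t
  have het : e.hom ≫ pullbackLift (Hom.base t) = t :=
    IsCartesian.fac (proj P) (Hom.base t) (pullbackLift (Hom.base t)) t
  -- A functor preserves the isomorphism `e`, and isomorphisms are Cartesian.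
  have hDe : (FibDual.proj (proj P)).IsStronglyCartesian (Hom.base e.hom)
      ((fibrewiseDual P).map e.hom) := by
    have : (FibDual.proj (proj P)).IsHomLift (Hom.base e.hom) ((fibrewiseDual P).map e.hom) :=
      IsHomLift.map (FibDual.proj (proj P)) ((fibrewiseDual P).map e.hom)
    infer_instance
  have h := IsStronglyCartesian.comp (FibDual.proj (proj P)) (f := Hom.base e.hom)
    (g := Hom.base (X := X) (Y := Y) t) (φ := (fibrewiseDual P).map e.hom)
    (ψ := (fibrewiseDual P).map (pullbackLift (Hom.base t)))
  rw [← Functor.map_comp, het] at h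
  have hb : Hom.base e.hom ≫ Hom.base (X := X) (Y := Y) t =
      Hom.base (X := X) (Y := Y) t := congrArg (Hom.base (X := X) (Y := Y)) het
  rw [hb] at h
  exact h

end VB

end

/-- The fibrewise linear dualization functors `VBun A ⥤ (VBun A)ᵒᵖ` extend canonically to a functor
`D` over the base category from vector bundles to the fibrewise dual of the fibration of vector
bundles, namely the unique one sending each bundle to its dual and each bundle map to the comorphism
given by the transposed fibre maps; and `D` preserves Cartesian arrows. -/
theorem mainTheorem6 (n : ℕ∞ω) (P : ObjectProperty (Mfd.{u} n)) :
    ∃ D : VB P ⥤ FibDual (VB.proj P),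
      D ⋙ FibDual.proj (VB.proj P) = VB.proj P ∧
      (∀ A : P.FullSubcategory,
        VB.ofFibre A ⋙ D =
          VBun.dualFunctor A.obj ⋙ (VB.toFibre A).op ⋙ FibDual.fibreOp (VB.proj P) A) ∧
      VB.IsFibrewiseDual D ∧
      (∀ D' : VB P ⥤ FibDual (VB.proj P), VB.IsFibrewiseDual D' → D' = D) ∧
      (∀ (X Y : VB P) (t : X ⟶ Y),
        (VB.proj P).IsStronglyCartesian ((VB.proj P).map t) t →
          (FibDual.proj (VB.proj P)).IsStronglyCartesian
            ((FibDual.proj (VB.proj P)).map (D.map t)) (D.map t)) :=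
  ⟨VB.fibrewiseDual P, VB.fibrewiseDual_comp_proj, VB.ofFibre_comp_fibrewiseDual,
    VB.isFibrewiseDual_fibrewiseDual, fun _ => VB.IsFibrewiseDual.eq_fibrewiseDual,
    fun _ _ => VB.isStronglyCartesian_fibrewiseDual_map⟩
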